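/- Let $G$ be a finite group. For a subgroup $H\le G$ put $\hat H=\frac1{|H|}\sum_{h\in H}h\in\mathbb{Q}[G]$ and $\operatorname{core}_G(H)=\bigcap_{x\in G}xHx^{-1}$. For $K\trianglelefteq H\le G$ let $\varepsilon(H,K)=\hat H$ if $H=K$, and $\varepsilon(H,K)=\prod_L(\hat K-\hat L)$ otherwise, where $L$ runs over the minimal elements of the set of normal subgroups of $H$ that contain $K$ properly. A strong Shoda pair of $G$ is a pair $(H,K)$ of subgroups of $G$ such that (i) $K\trianglelefteq H\trianglelefteq N_G(K)$; (ii) $H/K$ is cyclic and is a maximal abelian subgroup of $N_G(K)/K$; (iii) the distinct $G$-conjugates of $\varepsilon(H,K)$ are mutually orthogonal. For a normal subgroup $N$ of $G$, fix a normal subgroup $A_N\supseteq N$ of $G$ such that $A_N/N$ is an abelian normal subgroup of maximal order in $G/N$. Let $\mathcal{D}_N$ be the set of all subgroups $D$ with $N\le D\le A_N$ and $\operatorname{core}_G(D)=N$ such that $A_N/D$ is cyclic and is a maximal abelian subgroup of $N_G(D)/D$. Let $\mathcal{T}_N$ be a set of representatives of $\mathcal{D}_N$ under conjugacy of subgroups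 in $G$, and let $\mathcal{S}_N=\{(A_N,D)\mid D\in\mathcal{T}_N\}$. Lemma. If $(H,K)$ is a strong Shoda pair of $G$ and $N=\operatorname{core}_G(K)$, then the centre of $G/N$ is cyclic. In particular, if $N$ is a normal subgroup of $G$ such that the centre of $G/N$ is not cyclic, then $\mathcal{S}_N=\emptyset$, whatever the choices of $A_N$ and $\mathcal{T}_N$. -/

import Mathlib

namespace ShodaPair

variable {G : Type*} [Group G]

/-- The element `Ĥ = |H|⁻¹ ∑_{h ∈ H} h` of the rational group algebra. -/
noncomputable def hat (H : Subgroup G) : MonoidAlgebra ℚ G :=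
  (Nat.card H : ℚ)⁻¹ • ∑ᶠ h : H, MonoidAlgebra.of ℚ G (h : G)

/-- The conjugate `g x g⁻¹` of an element `x` of the rational group algebra by `g ∈ G`. -/
noncomputable def conjBy (g : G) (x : MonoidAlgebra ℚ G) : MonoidAlgebra ℚ G :=
  MonoidAlgebra.of ℚ G g * x * MonoidAlgebra.of ℚ G g⁻¹

/-- The minimal members of the collection of normal subgroups of `H` that contain `K` properly.
Subgroups of `H` are regarded as subgroups of `G` that are contained in `H`. -/
def minimalNormalOver (H K : Subgroup G) : Set (Subgroup G) :=
  {L | Minimal (fun L : Subgroup G => L ≤ H ∧ (L.subgroupOf H).Normal ∧ K < L) L}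

theorem commute_of_hat [Finite G] {H L : Subgroup G} (hL : L ≤ H) (hn : (L.subgroupOf H).Normal)
    {g : G} (hg : g ∈ H) : Commute (MonoidAlgebra.of ℚ G g) (hat L) := by
  classical
  have : Fintype L := Fintype.ofFinite L
  unfold hat
  refine Commute.smul_right ?_ _
  rw [finsum_eq_sum_of_fintype, Commute, SemiconjBy, Finset.mul_sum, Finset.sum_mul]
  have hc : ∀ x : L, g * x * g⁻¹ ∈ L := fun x => by
    have := hn.conj_mem ⟨x, hL x.2⟩ (Subgroup.mem_subgroupOf.2 x.2) ⟨g, hg⟩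
    simpa [Subgroup.mem_subgroupOf] using this
  have hc' : ∀ x : L, g⁻¹ * x * g ∈ L := fun x => by
    have := hn.conj_mem ⟨x, hL x.2⟩ (Subgroup.mem_subgroupOf.2 x.2) ⟨g⁻¹, H.inv_mem hg⟩
    simpa [Subgroup.mem_subgroupOf] using this
  refine Fintype.sum_bijective (fun x : L => (⟨g * x * g⁻¹, hc x⟩ : L)) ?_ _ _ ?_
  · refine ⟨fun x y h => ?_, fun y => ⟨⟨g⁻¹ * y * g, hc' y⟩, ?_⟩⟩
    · have h' : g * (x : G) * g⁻¹ = g * (y : G) * g⁻¹ := congrArg Subtype.val h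
      exact Subtype.ext (mul_left_cancel (mul_right_cancel h'))
    · exact Subtype.ext (by simp [mul_assoc])
  · intro x
    rw [← map_mul, ← map_mul]
    simp

theorem commute_hat_hat [Finite G] {H L M : Subgroup G} (hL : L ≤ H)
    (hn : (L.subgroupOf H).Normal) (hM : M ≤ H) : Commute (hat M) (hat L) := by
  have : Fintype M := Fintype.ofFinite M
  rw [hat.eq_def M, finsum_eq_sum_of_fintype]
  exact Commute.smul_left (Commute.sum_left _ _ _ fun m _ => commute_of_hat hL hn (hM m.2)) _

theorem commute_factors [Finite G] (H K : Subgroup G) :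
    ((Set.toFinite (minimalNormalOver H K)).toFinset : Set (Subgroup G)).Pairwise
      (Function.onFun Commute fun L => hat K - hat L) := by
  intro L hL M hM _
  simp only [Set.Finite.coe_toFinset, minimalNormalOver, Set.mem_ofPred_eq] at hL hM
  obtain ⟨hLH, hLn, hKL⟩ := hL.prop
  obtain ⟨hMH, hMn, hKM⟩ := hM.prop
  have hKH : K ≤ H := hKL.le.trans hLH
  have h1 : Commute (hat K) (hat M) := commute_hat_hat hMH hMn hKH
  have h2 : Commute (hat L) (hat K) := (commute_hat_hat hLH hLn hKH).symm
  have h3 : Commute (hat L) (hat M) := commute_hat_hat hMH hMn hLH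
  exact ((Commute.refl _).sub_right h1).sub_left (h2.sub_right h3)

open Classical in
/-- `ε(H, K)`: it is `Ĥ` if `H = K`, and otherwise the product of the pairwise commuting elements
`K̂ - L̂`, where `L` runs over the minimal normal subgroups of `H` containing `K` properly. -/
noncomputable def epsilon [Finite G] (H K : Subgroup G) : MonoidAlgebra ℚ G :=
  if H = K then hat H
  else (Set.toFinite (minimalNormalOver H K)).toFinset.noncommProd
    (fun L => hat K - hat L) (commute_factors H K)

/-- The distinct `G`-conjugates of `x` are mutually orthogonal. -/
def OrthogonalConjugates (x : MonoidAlgebra ℚ G) : Prop :=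
  ∀ g g' : G, conjBy g x ≠ conjBy g' x → conjBy g x * conjBy g' x = 0

/-- The subgroup `H/K` of `N_G(K)/K`, for subgroups `K ≤ H ≤ N_G(K)`. -/
def quotInNormalizer (H K : Subgroup G) :
    Subgroup (Subgroup.normalizer (K : Set G) ⧸ K.subgroupOf (Subgroup.normalizer (K : Set G))) :=
  (H.subgroupOf (Subgroup.normalizer (K : Set G))).map
    (QuotientGroup.mk' (K.subgroupOf (Subgroup.normalizer (K : Set G))))

/-- `A` is a maximal abelian subgroup of the ambient group: it is abelian and not properly
contained in any abelian subgroup. -/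
def IsMaximalAbelian {Q : Type*} [Group Q] (A : Subgroup Q) : Prop :=
  Maximal (fun B : Subgroup Q => IsMulCommutative B) A

/-- `(H, K)` is a strong Shoda pair of `G`. -/
structure IsStrongShodaPair [Finite G] (H K : Subgroup G) : Prop where
  le : K ≤ H
  normal : (K.subgroupOf H).Normal
  le_normalizer : H ≤ Subgroup.normalizer (K : Set G)
  normal_normalizer : (H.subgroupOf (Subgroup.normalizer (K : Set G))).Normal
  isCyclic : IsCyclic (quotInNormalizer H K)
  isMaximalAbelian : IsMaximalAbelian (quotInNormalizer H K)
  orthogonal : OrthogonalConjugates (epsilon H K)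

/-- `A` is an admissible choice of `A_N`: a normal subgroup of `G` containing `N` such that `A/N` is
an abelian normal subgroup of maximal order in `G/N`. -/
structure IsMaxOrderAbelianNormalOver (N : Subgroup G) [N.Normal] (A : Subgroup G) : Prop where
  normal : A.Normal
  le : N ≤ A
  isMulCommutative : IsMulCommutative (A.map (QuotientGroup.mk' N))
  card_le : ∀ B : Subgroup (G ⧸ N), B.Normal → IsMulCommutative B →
    Nat.card B ≤ Nat.card (A.map (QuotientGroup.mk' N))

/-- The set `𝒟_N` for the choice `A` of `A_N`: all subgroups `D` of `A` containing `N` with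
`core_G(D) = N` such that `A/D` is cyclic and is a maximal abelian subgroup of `N_G(D)/D`. -/
def setD (N A : Subgroup G) : Set (Subgroup G) :=
  {D | N ≤ D ∧ D ≤ A ∧ D.normalCore = N ∧ IsCyclic (quotInNormalizer A D) ∧
    IsMaximalAbelian (quotInNormalizer A D)}

/-- `D` and `D'` are conjugate in `G`. -/
def ConjSubgroups (D D' : Subgroup G) : Prop :=
  ∃ g : G, D.map (MulAut.conj g).toMonoidHom = D'

/-- `T` is a set of representatives of `𝒟` under conjugacy of subgroups in `G`. -/
def IsConjTransversal (𝒟 T : Set (Subgroup G)) : Prop :=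
  T ⊆ 𝒟 ∧ ∀ D ∈ 𝒟, ∃! D', D' ∈ T ∧ ConjSubgroups D D'

/-- The set `𝒮_N` for the choice `A` of `A_N` and the choice `T` of `𝒯_N`. -/
def setS (A : Subgroup G) (T : Set (Subgroup G)) : Set (Subgroup G × Subgroup G) :=
  {p | p.1 = A ∧ p.2 ∈ T}

end ShodaPair

namespace ShodaPair

/-! Let `N` be the core of `K` and `Z` the preimage in `G` of the centre of `G/N`. Commutators of
`Z` with `G` lie in `N ≤ K`, so `Z` normalises `K` and has central image in `N_G(K)/K`. A maximal
abelian subgroup contains the centre, so this image lies in the cyclic group `H/K`. An element of `Z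
∩ K` has all its conjugates in `K`, hence lies in `N`; thus `Z/N` embeds in `H/K` and is cyclic. The
pairs in `𝒮_N` satisfy the same two conditions, cyclic and maximal abelian. -/

/-- A maximal abelian subgroup contains the centre of the ambient group. -/
theorem IsMaximalAbelian.center_le {Q : Type*} [Group Q] {A : Subgroup Q}
    (hA : IsMaximalAbelian A) : Subgroup.center Q ≤ A := by
  have hcomm : ∀ x ∈ A, ∀ y ∈ A, x * y = y * x := fun x hx y hy =>
    congrArg Subtype.val (hA.prop.is_comm.comm ⟨x, hx⟩ ⟨y, hy⟩)
  -- Adjoining central elements keeps `A` abelian, so maximality gives `A ⊔ center Q ≤ A`.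
  have hsup : IsMulCommutative (A ⊔ Subgroup.center Q : Subgroup Q) := by
    refine ⟨⟨?_⟩⟩
    rintro ⟨x, hx⟩ ⟨y, hy⟩
    obtain ⟨a, ha, z, hz, rfl⟩ := Subgroup.mem_sup_of_normal_right.1 hx
    obtain ⟨b, hb, w, hw, rfl⟩ := Subgroup.mem_sup_of_normal_right.1 hy
    rw [Subgroup.mem_center_iff] at hz hw
    refine Subtype.ext ?_
    change a * z * (b * w) = b * w * (a * z)
    calc a * z * (b * w) = a * (z * b) * w := by group
      _ = a * b * (z * w) := by rw [← hz b]; group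
      _ = b * a * (w * z) := by rw [hcomm a ha b hb, hw z]
      _ = b * (a * w) * z := by group
      _ = b * w * (a * z) := by rw [hw a]; group
  exact le_sup_right.trans (hA.le_of_ge hsup le_sup_left)

/-- The elements of `G` that are central modulo the core of `K` normalise `K`. -/
theorem comap_center_le_normalizer {G : Type*} [Group G] (K : Subgroup G) :
    (Subgroup.center (G ⧸ K.normalCore)).comap (QuotientGroup.mk' K.normalCore) ≤
      Subgroup.normalizer (K : Set G) := by
  have key : ∀ z ∈ (Subgroup.center (G ⧸ K.normalCore)).comap (QuotientGroup.mk' K.normalCore),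
      ∀ k ∈ K, z * k * z⁻¹ ∈ K := by
    intro z hz k hk
    have h := Subgroup.mem_center_iff.1 (Subgroup.mem_comap.1 hz) (k : G ⧸ K.normalCore)
    -- `z` and `k` commute modulo the core, so `z * k * z⁻¹` lies in the coset `kK = K`.
    have h' : k⁻¹ * (z * k * z⁻¹) ∈ K.normalCore := by
      rw [← QuotientGroup.eq]
      simp only [QuotientGroup.mk'_apply] at h
      simp [← h]
    simpa using K.mul_mem hk (K.normalCore_le h')
  intro z hz
  rw [Subgroup.mem_normalizer_iff]
  refine fun k => ⟨key z hz k, fun hk => ?_⟩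
  simpa [mul_assoc] using key z⁻¹ (Subgroup.inv_mem _ hz) _ hk

/-- If the image of `H` in `N_G(K)/K` is cyclic and maximal abelian, then the centre of
`G / core_G(K)` is cyclic, as it embeds into that image. -/
theorem isCyclic_center_quotient_normalCore {G : Type*} [Group G] {H K : Subgroup G}
    (hcyc : IsCyclic (quotInNormalizer H K)) (hmax : IsMaximalAbelian (quotInNormalizer H K)) :
    IsCyclic (Subgroup.center (G ⧸ K.normalCore)) := by
  set M := Subgroup.normalizer (K : Set G)
  set Z := (Subgroup.center (G ⧸ K.normalCore)).comap (QuotientGroup.mk' K.normalCore)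
  have hcent : ∀ z ∈ Z, ∀ g : G, (g * z)⁻¹ * (z * g) ∈ K.normalCore := fun z hz g =>
    QuotientGroup.eq.1 (Subgroup.mem_center_iff.1 (Subgroup.mem_comap.1 hz) (g : G ⧸ K.normalCore))
  let f : Z →* M ⧸ K.subgroupOf M := (QuotientGroup.mk' (K.subgroupOf M)).comp
    (Subgroup.inclusion (comap_center_le_normalizer K))
  have hrange : f.range ≤ quotInNormalizer H K := by
    refine le_trans ?_ hmax.center_le
    rintro _ ⟨z, rfl⟩
    rw [Subgroup.mem_center_iff]
    intro q
    obtain ⟨g, rfl⟩ := QuotientGroup.mk_surjective q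
    exact QuotientGroup.eq.2 (Subgroup.mem_subgroupOf.2 (K.normalCore_le (hcent z z.2 g)))
  let p : Z →* Subgroup.center (G ⧸ K.normalCore) :=
    (QuotientGroup.mk' K.normalCore).subgroupComap (Subgroup.center (G ⧸ K.normalCore))
  have hker : f.ker ≤ p.ker := by
    intro z hz
    have hzK : (z : G) ∈ K :=
      Subgroup.mem_subgroupOf.1 ((QuotientGroup.eq_one_iff
        (Subgroup.inclusion (comap_center_le_normalizer K) z)).1 (MonoidHom.mem_ker.1 hz))
    rw [MonoidHom.mem_ker]
    refine Subtype.ext ((QuotientGroup.eq_one_iff (z : G)).2 fun g => ?_)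
    -- With `g⁻¹` in place of `g`, the product of `z` and the commutator collapses to `g * z * g⁻¹`.
    have h := K.mul_mem hzK (K.normalCore_le (hcent z z.2 g⁻¹))
    simpa [mul_assoc] using h
  have : IsCyclic f.range :=
    have := hcyc
    isCyclic_of_injective (Subgroup.inclusion hrange) (Subgroup.inclusion_injective hrange)
  have : IsCyclic (Z ⧸ f.ker) :=
    isCyclic_of_surjective (QuotientGroup.quotientKerEquivRange f).symm
      (QuotientGroup.quotientKerEquivRange f).symm.surjective
  -- Since `f.ker ≤ p.ker`, the surjection `p` factors through the cyclic group `Z ⧸ f.ker`.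
  refine isCyclic_of_surjective (QuotientGroup.lift f.ker p hker)
    (QuotientGroup.lift_surjective_of_surjective _ _ ?_ _)
  rintro ⟨q, hq⟩
  obtain ⟨g, rfl⟩ := QuotientGroup.mk_surjective q
  exact ⟨⟨g, hq⟩, rfl⟩

end ShodaPair

theorem lemma3p3 {G : Type*} [Group G] [Finite G] :
    (∀ H K : Subgroup G, ShodaPair.IsStrongShodaPair H K →
      IsCyclic (Subgroup.center (G ⧸ K.normalCore))) ∧
    (∀ (N : Subgroup G) [N.Normal], ¬ IsCyclic (Subgroup.center (G ⧸ N)) →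
      ∀ A : Subgroup G, ShodaPair.IsMaxOrderAbelianNormalOver N A →
      ∀ T : Set (Subgroup G), ShodaPair.IsConjTransversal (ShodaPair.setD N A) T →
        ShodaPair.setS A T = ∅) := by
  refine ⟨fun H K h =>
    ShodaPair.isCyclic_center_quotient_normalCore h.isCyclic h.isMaximalAbelian, ?_⟩
  intro N _ hN A _ T hT
  refine Set.eq_empty_of_forall_notMem ?_
  rintro ⟨_, D⟩ ⟨-, hD⟩
  -- Here `N` becomes `D.normalCore`, so the criterion applies to the pair `(A, D)`.
  obtain ⟨-, -, rfl, hcyc, hmax⟩ := hT.1 hD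
  exact hN (ShodaPair.isCyclic_center_quotient_normalCore hcyc hmax)
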